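/- Let $A$ be an infinite set of natural numbers. For $n\in\mathbb{N}$ let $r(A,n)$ denote the number of solutions of the equation $n=a+b$ with $a,b\in A$ and $a\le b$, and for real $x$ let $|A(x)|$ denote the number of elements of $A$ that are less than or equal to $x$. If $r(A,n)\neq 1$ for all sufficiently large integers $n$, then $$|A(x)|>\frac12\left(\frac{\log x}{\log\log x}\right)^2$$ for all sufficiently large real numbers $x$. -/

import Mathlib

open Filter

/-- `r(A, n)`: the number of solutions of `n = a + b` with `a, b ∈ A` and `a ≤ b`. The set of
solutions is finite, so `Set.ncard` is its number of elements. -/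
noncomputable def repCount (A : Set ℕ) (n : ℕ) : ℕ :=
  Set.ncard {p : ℕ × ℕ | p.1 ∈ A ∧ p.2 ∈ A ∧ p.1 ≤ p.2 ∧ n = p.1 + p.2}

/-- `|A(x)|`: the number of elements of `A` that are at most the real number `x`. The set is
finite, so `Set.ncard` is its number of elements. -/
noncomputable def countUpTo (A : Set ℕ) (x : ℝ) : ℕ :=
  Set.ncard {a : ℕ | a ∈ A ∧ (a : ℝ) ≤ x}

/-! Cut the integers into blocks (B^J, B^(J+1)] with B = 64n, where n is at least a large multiple
of the number K of blocks. Blocks with at least n/2 elements already contribute enough, so the point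
is that a sparse block J still has about J elements (`HasSecondRep.card_sparse_le_countIoc`).

If it had fewer elements than there are sparse scales j ≤ J, pigeonhole
(`exists_simultaneous_approx`) would give θ of order B^(-j), for one such j, with θc close to an
integer for every c in the block. The block contains some k preceded by a long gap
(`HasSecondRep.exists_gap`). For small u in A, the second representation of u + k forces an element
p < u of A with θp just below θu (`HasSecondRep.exists_descent`). Descending from θu near 1/2 then
puts at least n elements of A around scale j, which is not sparse after all. Summing over J < K
gives about K²/2 elements. -/

/-! ### Second representations and gaps -/

/-- The number of elements of `A` in the interval `(a, b]`. -/
noncomputable def countIoc (A : Set ℕ) (a b : ℕ) : ℕ :=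
  Set.ncard {c : ℕ | c ∈ A ∧ a < c ∧ c ≤ b}

/-- Every sum `a + b ≥ n₀` of two elements of `A` has a second representation. -/
def HasSecondRep (A : Set ℕ) (n₀ : ℕ) : Prop :=
  ∀ a ∈ A, ∀ b ∈ A, a ≤ b → n₀ ≤ a + b → ∃ p ∈ A, ∃ q ∈ A, p ≤ q ∧ p + q = a + b ∧ p ≠ a

theorem hasSecondRep_of_repCount_ne_one {A : Set ℕ} {n₀ : ℕ}
    (h : ∀ n, n₀ ≤ n → repCount A n ≠ 1) : HasSecondRep A n₀ := by
  intro a ha b hb hab hn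
  by_contra hcon
  push Not at hcon
  refine h (a + b) hn ?_
  unfold repCount
  rw [Set.ncard_eq_one]
  refine ⟨(a, b), ?_⟩
  ext ⟨p, q⟩
  simp only [Set.mem_ofPred_eq, Set.mem_singleton_iff, Prod.mk.injEq]
  constructor
  · rintro ⟨hp, hq, hpq, hs⟩
    have := hcon p hp q hq hpq hs.symm
    omega
  · rintro ⟨rfl, rfl⟩
    exact ⟨ha, hb, hab, rfl⟩

theorem finite_Ioc_inter (A : Set ℕ) (a b : ℕ) : {c : ℕ | c ∈ A ∧ a < c ∧ c ≤ b}.Finite :=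
  (Set.finite_Iic b).subset fun _ hc => hc.2.2

/-- Let a be the largest element up to v. The larger summand in a second representation of a + a
exceeds a, hence v. -/
theorem HasSecondRep.exists_mem_Ioc_two_mul {A : Set ℕ} {n₀ a₀ v : ℕ} (h : HasSecondRep A n₀)
    (ha₀ : a₀ ∈ A) (hn : n₀ ≤ a₀) (hv : a₀ ≤ v) : ∃ c ∈ A, v < c ∧ c ≤ 2 * v := by
  have hfin : {a : ℕ | a ∈ A ∧ a ≤ v}.Finite := (Set.finite_Iic v).subset fun _ hc => hc.2
  obtain ⟨a, ⟨haA, hav⟩, hmax⟩ := hfin.exists_maximal ⟨a₀, ha₀, hv⟩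
  have hmax' : ∀ b ∈ A, b ≤ v → b ≤ a := fun b hb hbv => by
    rcases le_total b a with h | h
    · exact h
    · exact hmax ⟨hb, hbv⟩ h
  have h0 := hmax' a₀ ha₀ hv
  obtain ⟨p, hp, q, hq, hpq, hs, hne⟩ := h a haA a haA le_rfl (by omega)
  refine ⟨q, hq, ?_, by omega⟩
  by_contra hlt
  have := hmax' q hq (by omega)
  omega

/-- A sparse block contains an element preceded by a long gap. -/
theorem HasSecondRep.exists_gap {A : Set ℕ} {n₀ a₀ y n B : ℕ} (h : HasSecondRep A n₀)
    (ha₀ : a₀ ∈ A) (hn : n₀ ≤ a₀) (hy : a₀ ≤ y) (hy0 : 0 < y) (hB : 64 * n ≤ B)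
    (hcount : countIoc A y (B * y) < n) :
    ∃ k ∈ A, 3 * y < k ∧ k + y ≤ B * y ∧ ∀ c ∈ A, c < k → c + y < k := by
  classical
  -- These n disjoint intervals of length y lie in the block, so one of them misses A; the first
  -- element after it is the required k.
  have hempty : ∃ i ∈ Finset.Ico 3 (n + 3), ∀ c ∈ A, ¬(i * y < c ∧ c ≤ (i + 1) * y) := by
    by_contra hcon
    push Not at hcon
    choose! g hgA hg using hcon
    have hle : (Finset.Ico 3 (n + 3)).card ≤ (finite_Ioc_inter A y (B * y)).toFinset.card := by
      refine Finset.card_le_card_of_injOn g ?_ ?_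
      · intro i hi
        have hi' := Finset.mem_Ico.1 hi
        have h1 := hg i hi
        have h2 : (i + 1) * y ≤ B * y := Nat.mul_le_mul_right _ (by omega)
        have h3 : 1 * y ≤ i * y := Nat.mul_le_mul_right _ (by omega)
        simp only [Set.Finite.coe_toFinset, Set.mem_ofPred_eq]
        exact ⟨hgA i hi, by omega, by omega⟩
      · intro i hi j hj hij
        have h1 := hg i hi
        have h2 := hg j hj
        rw [hij] at h1
        have h3 : i < j + 1 := lt_of_mul_lt_mul_right (h1.1.trans_le h2.2) (Nat.zero_le y)
        have h4 : j < i + 1 := lt_of_mul_lt_mul_right (h2.1.trans_le h1.2) (Nat.zero_le y)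
        omega
    rw [← Set.ncard_eq_toFinset_card _ (finite_Ioc_inter A y (B * y)), Nat.card_Ico] at hle
    unfold countIoc at hcount
    omega
  obtain ⟨i, hi, hie⟩ := hempty
  have hi' := Finset.mem_Ico.1 hi
  have hiy : 3 * y ≤ i * y := Nat.mul_le_mul_right _ hi'.1
  obtain ⟨c, hcA, hc1, hc2⟩ := h.exists_mem_Ioc_two_mul ha₀ hn (v := i * y) (by omega)
  have hex : ∃ k, k ∈ A ∧ i * y < k := ⟨c, hcA, hc1⟩
  obtain ⟨hkA, hk⟩ := Nat.find_spec hex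
  have hkc : Nat.find hex ≤ c := Nat.find_min' hex ⟨hcA, hc1⟩
  have hk2 := hie _ hkA
  rw [add_mul] at hk2
  refine ⟨Nat.find hex, hkA, by omega, ?_, ?_⟩
  · have : (2 * i + 1) * y ≤ B * y := Nat.mul_le_mul_right _ (by omega)
    have h2 : (2 * i + 1) * y = 2 * (i * y) + y := by ring
    omega
  · intro d hdA hd
    have := Nat.find_min hex hd
    have hdi : d ≤ i * y := by
      by_contra hlt
      exact this ⟨hdA, by omega⟩
    omega

theorem lt_of_near_int {t ε : ℝ} (ht : t ≤ 1 / 2) (hε : ε ≤ 1 / 2) {N : ℤ} (h : |t - N| < ε) :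
    t < ε := by
  have h' := abs_lt.1 h
  rcases le_or_gt N 0 with hN | hN
  · have : (N : ℝ) ≤ 0 := by exact_mod_cast hN
    linarith
  · have : (1 : ℝ) ≤ N := by exact_mod_cast hN
    linarith

/-! ### Descent below a sparse block -/

/-- If all multiples `θ c`, for `c` in the block above `y`, are close to integers, then the
elements of `A` below `y` can be descended in steps that are short on the scale `1 / θ`. -/
theorem HasSecondRep.exists_descent {A : Set ℕ} {n₀ y k B u : ℕ} (h : HasSecondRep A n₀)
    (hy : n₀ ≤ y) (hkA : k ∈ A) (hk : 3 * y < k) (hkB : k + y ≤ B * y)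
    (hgap : ∀ c ∈ A, c < k → c + y < k) {θ Q : ℝ} (hθ : 0 < θ) (hQ : 6 ≤ Q)
    (hnear : ∀ c ∈ A, y < c → c ≤ B * y → ∃ N : ℤ, |θ * c - N| < 1 / Q)
    (huA : u ∈ A) (huy : u ≤ y) (hu : 3 / Q < θ * u) (hu' : θ * u ≤ 1 / 2) :
    ∃ p ∈ A, p < u ∧ θ * u < θ * p + 2 / Q := by
  have hQ0 : 0 < Q := by linarith
  have e3 : 3 / Q = 3 * (1 / Q) := by ring
  have e2 : 2 / Q = 2 * (1 / Q) := by ring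
  have hQ6 : 1 / Q ≤ 1 / 6 := one_div_le_one_div_of_le (by norm_num) hQ
  obtain ⟨p, hp, q, hq, hpq, hs, hne⟩ := h u huA k hkA (by omega) (by omega)
  have hsR : (p : ℝ) + q = u + k := by exact_mod_cast hs
  obtain ⟨Nk, hNk⟩ := hnear k hkA (by omega) (by omega)
  obtain ⟨Nq, hNq⟩ := hnear q hq (by omega) (by omega)
  rw [abs_lt] at hNk hNq
  have hmul : θ * p + θ * q = θ * u + θ * k := by rw [← mul_add, hsR, mul_add]
  -- If q < k, the gap pushes p above y as well, so θu is within 3/Q of an integer, which is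
  -- excluded. If q > k, then θ(u - p) = θ(q - k) is within 2/Q of an integer and at most 1/2, hence
  -- small.
  rcases lt_trichotomy q k with hlt | heq | hgt
  · have hg := hgap q hq hlt
    obtain ⟨Np, hNp⟩ := hnear p hp (by omega) (by omega)
    rw [abs_lt] at hNp
    have := lt_of_near_int (t := θ * u) (ε := 3 / Q) (N := Np + Nq - Nk) hu' (by linarith)
      (by push_cast; rw [abs_lt]; constructor <;> linarith [hNk.1, hNk.2])
    linarith
  · omega
  · refine ⟨p, hp, by omega, ?_⟩
    have hp0 : 0 ≤ θ * p := by positivity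
    have := lt_of_near_int (t := θ * u - θ * p) (ε := 2 / Q) (N := Nq - Nk) (by linarith)
      (by linarith) (by push_cast; rw [abs_lt]; constructor <;> linarith [hNk.1, hNk.2])
    linarith

/-- Steps shorter than 2/(16n) cannot jump over any of the n windows [4+3i, 6+3i)/(16n); these are
disjoint and start at or below 1/4. -/
theorem le_countIoc_of_descent {A : Set ℕ} {n u₀ lo hi : ℕ} {θ : ℝ} (hn : 0 < n)
    (hu₀ : u₀ ∈ A) (h4 : 1 / 4 < θ * u₀) (hhi : u₀ ≤ hi)
    (hlo : ∀ u : ℕ, 4 / (16 * n : ℝ) ≤ θ * u → lo < u)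
    (hdesc : ∀ u ∈ A, u ≤ u₀ → 3 / (16 * n : ℝ) < θ * u →
      ∃ p ∈ A, p < u ∧ θ * u < θ * p + 2 / (16 * n : ℝ)) :
    n ≤ countIoc A lo hi := by
  classical
  have hnR : (0 : ℝ) < n := by exact_mod_cast hn
  have key : ∀ i ∈ Finset.range n, ∃ u ∈ A, u ≤ u₀ ∧ (4 + 3 * i) / (16 * n : ℝ) ≤ θ * u ∧
      θ * u < (6 + 3 * i) / (16 * n : ℝ) := by
    intro i hi
    have hi' : (i : ℝ) + 1 ≤ n := by exact_mod_cast Finset.mem_range.1 hi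
    have htop : (4 + 3 * i) / (16 * n : ℝ) ≤ θ * u₀ := by
      refine le_trans ?_ h4.le
      rw [div_le_iff₀ (by positivity)]
      linarith
    have hex : ∃ u, u ∈ A ∧ (4 + 3 * i) / (16 * n : ℝ) ≤ θ * (u : ℝ) := ⟨u₀, hu₀, htop⟩
    obtain ⟨hA, hge⟩ := Nat.find_spec hex
    have hle : Nat.find hex ≤ u₀ := Nat.find_min' hex ⟨hu₀, htop⟩
    refine ⟨Nat.find hex, hA, hle, hge, ?_⟩
    obtain ⟨p, hp, hpu, hpθ⟩ := hdesc _ hA hle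
      (lt_of_lt_of_le (by gcongr; linarith [i.cast_nonneg (α := ℝ)]) hge)
    have := Nat.find_min hex hpu
    have h2 : θ * p < (4 + 3 * i) / (16 * n : ℝ) := by
      by_contra hcon
      exact this ⟨hp, not_lt.1 hcon⟩
    have e : (6 + 3 * i) / (16 * n : ℝ) = (4 + 3 * i) / (16 * n : ℝ) + 2 / (16 * n : ℝ) := by ring
    linarith
  choose! g hgA hgu hg1 hg2 using key
  have hle : (Finset.range n).card ≤ (finite_Ioc_inter A lo hi).toFinset.card := by
    refine Finset.card_le_card_of_injOn g ?_ ?_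
    · intro i hi
      simp only [Set.Finite.coe_toFinset, Set.mem_ofPred_eq]
      refine ⟨hgA i hi, hlo _ (le_trans ?_ (hg1 i hi)), (hgu i hi).trans hhi⟩
      gcongr
      linarith [i.cast_nonneg (α := ℝ)]
    · intro i hi j hj hij
      have hij' : (g i : ℝ) = g j := by exact_mod_cast hij
      have a := (hg1 i hi).trans_lt (hij' ▸ hg2 j hj)
      have b := (hg1 j hj).trans_lt (hij' ▸ hg2 i hi)
      rw [div_lt_div_iff_of_pos_right (by positivity)] at a b
      have a' : (i : ℝ) < j + 1 := by linarith
      have b' : (j : ℝ) < i + 1 := by linarith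
      norm_cast at a' b'
      omega
  rwa [← Set.ncard_eq_toFinset_card _ (finite_Ioc_inter A lo hi), Finset.card_range] at hle

/-! ### Simultaneous approximation -/

theorem exists_int_abs_sub_sub_lt {x y : ℝ} {Q : ℕ} (hQ : 0 < Q)
    (h : ⌊Int.fract x * Q⌋ = ⌊Int.fract y * Q⌋) : ∃ N : ℤ, |x - y - N| < 1 / (Q : ℝ) := by
  have hQR : (0 : ℝ) < Q := by exact_mod_cast hQ
  refine ⟨⌊x⌋ - ⌊y⌋, ?_⟩
  have h1 := Int.abs_sub_lt_one_of_floor_eq_floor h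
  rw [← sub_mul, abs_mul, abs_of_pos hQR, ← lt_div_iff₀ hQR] at h1
  have e : x - y - ((⌊x⌋ - ⌊y⌋ : ℤ) : ℝ) = Int.fract x - Int.fract y := by
    push_cast
    rw [← Int.self_sub_floor x, ← Int.self_sub_floor y]
    ring
  rwa [e]

/-- A nonzero number written with digits smaller than `Q` in base `4 * Q` is of the size of its
leading term. -/
theorem abs_digit_sum_bounds {Q : ℕ} (hQ : 0 < Q) (S : Finset ℕ) {e : ℕ → ℤ}
    (he : ∀ j, |e j| ≤ Q - 1) (hne : ∃ j ∈ S, e j ≠ 0) :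
    ∃ j ∈ S, ((4 * Q : ℝ) ^ j)⁻¹ / 2 ≤ |∑ i ∈ S, e i * ((4 * Q : ℝ) ^ i)⁻¹| ∧
      |∑ i ∈ S, e i * ((4 * Q : ℝ) ^ i)⁻¹| ≤ Q * ((4 * Q : ℝ) ^ j)⁻¹ := by
  classical
  have hQR : (1 : ℝ) ≤ Q := by exact_mod_cast hQ
  set b : ℝ := (4 * Q : ℝ)⁻¹ with hb
  have hb0 : 0 < b := by positivity
  have hbQ : (Q : ℝ) * b = 1 / 4 := by rw [hb]; field_simp
  have hb4 : b ≤ 1 / 4 := by nlinarith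
  simp only [← inv_pow, ← hb]
  have hex : ∃ j, j ∈ S ∧ e j ≠ 0 := hne
  obtain ⟨hjS, hj⟩ := Nat.find_spec hex
  set j := Nat.find hex with hjdef
  have hbefore : ∀ i ∈ S, i < j → e i = 0 := fun i hi hij => by
    by_contra h0
    exact Nat.find_min hex hij ⟨hi, h0⟩
  have hsplit := Finset.add_sum_erase S (fun i => (e i : ℝ) * b ^ i) hjS
  -- Geometric tail: Qb = 1/4 leaves at most half of b^j.
  have hrest : |∑ i ∈ S.erase j, (e i : ℝ) * b ^ i| ≤ b ^ j / 2 := by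
    have hsum : Summable fun i : ℕ => (Q : ℝ) * b ^ (j + 1) * b ^ i :=
      (summable_geometric_of_lt_one hb0.le (by linarith)).mul_left _
    have hmem : ∀ i ∈ S.erase j, e i ≠ 0 → j + 1 ≤ i := fun i hi h0 => by
      have := Finset.mem_erase.1 hi
      by_contra hlt
      exact h0 (hbefore i this.2 (by omega))
    calc |∑ i ∈ S.erase j, (e i : ℝ) * b ^ i|
        ≤ ∑ i ∈ S.erase j, |(e i : ℝ) * b ^ i| := Finset.abs_sum_le_sum_abs _ _
      _ = ∑ i ∈ (S.erase j).filter (fun i => j + 1 ≤ i), |(e i : ℝ) * b ^ i| := by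
          rw [Finset.sum_filter_of_ne]
          intro i hi h0
          exact hmem i hi (by rintro h; simp [h] at h0)
      _ ≤ ∑ i ∈ (S.erase j).filter (fun i => j + 1 ≤ i),
            (Q : ℝ) * b ^ (j + 1) * b ^ (i - (j + 1)) := by
          refine Finset.sum_le_sum fun i hi => ?_
          have hi' := (Finset.mem_filter.1 hi).2
          rw [mul_assoc, ← pow_add, Nat.add_sub_cancel' hi', abs_mul, abs_of_pos (pow_pos hb0 i)]
          gcongr
          have : ((|e i| : ℤ) : ℝ) ≤ ((Q - 1 : ℤ) : ℝ) := by exact_mod_cast he i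
          push_cast at this
          linarith
      _ = ∑ i ∈ ((S.erase j).filter (fun i => j + 1 ≤ i)).image (fun i => i - (j + 1)),
            (Q : ℝ) * b ^ (j + 1) * b ^ i := by
          rw [Finset.sum_image]
          intro x hx y hy hxy
          have h1 := (Finset.mem_filter.1 hx).2
          have h2 := (Finset.mem_filter.1 hy).2
          simp only at hxy
          omega
      _ ≤ ∑' i : ℕ, (Q : ℝ) * b ^ (j + 1) * b ^ i :=
          hsum.sum_le_tsum _ fun i _ => by positivity
      _ = b ^ j * (1 / 4) * (1 - b)⁻¹ := by
          rw [tsum_mul_left, tsum_geometric_of_lt_one hb0.le (by linarith), pow_succ, ← hbQ]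
          ring
      _ ≤ b ^ j / 2 := by
          have : (1 - b)⁻¹ ≤ 2 := by
            rw [inv_le_comm₀ (by linarith) (by norm_num)]
            linarith
          have hp : 0 < b ^ j := pow_pos hb0 j
          nlinarith
  have hp : 0 < b ^ j := pow_pos hb0 j
  have hlead : |(e j : ℝ) * b ^ j| = |(e j : ℝ)| * b ^ j := by rw [abs_mul, abs_of_pos hp]
  have h1 : (1 : ℝ) ≤ |(e j : ℝ)| := by exact_mod_cast Int.one_le_abs hj
  have h2 : |(e j : ℝ)| ≤ Q - 1 := by exact_mod_cast he j
  refine ⟨j, hjS, ?_, ?_⟩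
  · have := abs_sub_abs_le_abs_add ((e j : ℝ) * b ^ j) (∑ i ∈ S.erase j, (e i : ℝ) * b ^ i)
    rw [hsplit] at this
    nlinarith
  · have := abs_add_le ((e j : ℝ) * b ^ j) (∑ i ∈ S.erase j, (e i : ℝ) * b ^ i)
    rw [hsplit] at this
    nlinarith

/-- Simultaneous approximation with multipliers restricted to prescribed scales. -/
theorem exists_simultaneous_approx {Q : ℕ} (hQ : 1 < Q) (S C : Finset ℕ) (hcard : C.card < S.card) :
    ∃ θ : ℝ, ∃ j ∈ S, ((4 * Q : ℝ) ^ j)⁻¹ / 2 ≤ θ ∧ θ ≤ Q * ((4 * Q : ℝ) ^ j)⁻¹ ∧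
      ∀ c ∈ C, ∃ N : ℤ, |θ * c - N| < 1 / (Q : ℝ) := by
  classical
  have hQR : (0 : ℝ) < Q := by exact_mod_cast (by omega : 0 < Q)
  let θ : (ℕ → ℕ) → ℝ := fun e => ∑ i ∈ S, e i * ((4 * Q : ℝ) ^ i)⁻¹
  let ext : (S → Fin Q) → ℕ → ℕ := fun e i => if h : i ∈ S then e ⟨i, h⟩ else 0
  have hbox : ∀ t : ℝ, (⌊Int.fract t * Q⌋).toNat < Q := fun t => by
    have h0 : 0 ≤ ⌊Int.fract t * Q⌋ := Int.floor_nonneg.2 (by have := Int.fract_nonneg t; positivity)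
    have h1 : ⌊Int.fract t * Q⌋ < Q := Int.floor_lt.2 (by
      have := Int.fract_lt_one t
      push_cast
      nlinarith)
    omega
  -- Each digit vector is sent to the boxes of the fractional parts of θc. There are Q^|S| vectors
  -- and only Q^|C| patterns, so two collide; θ is the absolute difference of their values.
  let F : (S → Fin Q) → C → Fin Q := fun e c => ⟨_, hbox (θ (ext e) * c)⟩
  obtain ⟨e, e', hne, hF⟩ := Fintype.exists_ne_map_eq_of_card_lt F
    (by simpa using Nat.pow_lt_pow_right hQ hcard)
  have hext : ∀ (e : S → Fin Q) i, ext e i < Q := fun e i => by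
    simp only [ext]
    split_ifs
    · exact (e _).2
    · omega
  obtain ⟨s, hs⟩ := Function.ne_iff.1 hne
  obtain ⟨j, hjS, hlow, hup⟩ := abs_digit_sum_bounds (Q := Q) (by omega) S
    (e := fun i => (ext e i : ℤ) - ext e' i)
    (fun i => by
      have h1 := hext e i
      have h2 := hext e' i
      rw [abs_le]
      constructor <;> omega)
    ⟨s, s.2, fun h => hs (by
      simp only [ext, s.2, dif_pos, Subtype.coe_eta] at h
      apply Fin.ext
      omega)⟩
  have hsum : ∑ i ∈ S, (((ext e i : ℤ) - ext e' i : ℤ) : ℝ) * ((4 * Q : ℝ) ^ i)⁻¹ =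
      θ (ext e) - θ (ext e') := by
    simp only [θ]
    rw [← Finset.sum_sub_distrib]
    refine Finset.sum_congr rfl fun i _ => ?_
    push_cast
    ring
  rw [hsum] at hlow hup
  refine ⟨|θ (ext e) - θ (ext e')|, j, hjS, hlow, hup, fun c hc => ?_⟩
  have hc' := congrArg Fin.val (congrFun hF ⟨c, hc⟩)
  simp only [F] at hc'
  have hpos : ∀ t : ℝ, 0 ≤ ⌊Int.fract t * Q⌋ := fun t =>
    Int.floor_nonneg.2 (by have := Int.fract_nonneg t; positivity)
  have h1 := hpos (θ (ext e) * c)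
  have h2 := hpos (θ (ext e') * c)
  obtain ⟨N, hN⟩ := exists_int_abs_sub_sub_lt (Q := Q) (by omega)
    (show ⌊Int.fract (θ (ext e) * c) * Q⌋ = ⌊Int.fract (θ (ext e') * c) * Q⌋ by omega)
  rcases abs_choice (θ (ext e) - θ (ext e')) with h | h <;> rw [h]
  · refine ⟨N, ?_⟩
    rwa [sub_mul]
  · refine ⟨-N, ?_⟩
    rw [← abs_neg] at hN
    convert hN using 2
    push_cast
    ring
-- Counting in blocks
theorem countIoc_add (A : Set ℕ) {a b c : ℕ} (hab : a ≤ b) (hbc : b ≤ c) :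
    countIoc A a b + countIoc A b c = countIoc A a c := by
  unfold countIoc
  rw [← Set.ncard_union_eq _ (finite_Ioc_inter A a b) (finite_Ioc_inter A b c)]
  · congr 1
    ext x
    simp only [Set.mem_union, Set.mem_ofPred_eq]
    constructor
    · rintro (⟨h, h1, h2⟩ | ⟨h, h1, h2⟩) <;> exact ⟨h, by omega, by omega⟩
    · rintro ⟨h, h1, h2⟩
      rcases le_or_gt x b with hx | hx
      · exact Or.inl ⟨h, h1, hx⟩
      · exact Or.inr ⟨h, hx, h2⟩
  · rw [Set.disjoint_left]
    rintro x ⟨_, _, h1⟩ ⟨_, h2, _⟩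
    omega

theorem sum_countIoc_pow (A : Set ℕ) {B : ℕ} (hB : 0 < B) (K : ℕ) :
    ∑ J ∈ Finset.range K, countIoc A (B ^ J) (B ^ (J + 1)) = countIoc A 1 (B ^ K) := by
  induction K with
  | zero =>
    have : {c : ℕ | c ∈ A ∧ 1 < c ∧ c ≤ 1} = ∅ := by
      ext x
      simp only [Set.mem_ofPred_eq, Set.mem_empty_iff_false, iff_false]
      omega
    simp [countIoc, this]
  | succ K ih =>
    rw [Finset.sum_range_succ, ih]
    exact countIoc_add A (Nat.one_le_pow _ _ hB) (Nat.pow_le_pow_right hB (by omega))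

/-- A sparse block has at least as many elements as there are sparse scales below it. -/
theorem HasSecondRep.card_sparse_le_countIoc {A : Set ℕ} {n₀ a₀ n J : ℕ} (h : HasSecondRep A n₀)
    (ha₀ : a₀ ∈ A) (hn₀ : n₀ ≤ a₀) (hn : 0 < n) (haB : a₀ ≤ 64 * n)
    (hJ : countIoc A ((64 * n) ^ J) ((64 * n) ^ (J + 1)) < n) :
    ((Finset.Icc 2 J).filter
      (fun j => countIoc A ((64 * n) ^ (j - 2)) ((64 * n) ^ j) < n)).card ≤
      countIoc A ((64 * n) ^ J) ((64 * n) ^ (J + 1)) := by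
  by_contra hcon
  rw [not_le] at hcon
  have hfin := finite_Ioc_inter A ((64 * n) ^ J) ((64 * n) ^ (J + 1))
  obtain ⟨θ, j, hjS, hlow, hup, hnear⟩ := exists_simultaneous_approx (Q := 16 * n) (by omega)
    ((Finset.Icc 2 J).filter
      (fun j => countIoc A ((64 * n) ^ (j - 2)) ((64 * n) ^ j) < n))
    hfin.toFinset (by rwa [← Set.ncard_eq_toFinset_card _ hfin])
  obtain ⟨hj, hsparse⟩ := Finset.mem_filter.1 hjS
  obtain ⟨hj2, hjJ⟩ := Finset.mem_Icc.1 hj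
  refine absurd hsparse (not_lt.2 ?_)
  have hnR : (1 : ℝ) ≤ n := by exact_mod_cast hn
  have hB : (4 * ((16 * n : ℕ) : ℝ)) = 64 * n := by push_cast; ring
  rw [hB] at hlow hup
  have hbpos : (0 : ℝ) < (64 * n : ℝ) ^ j := by positivity
  have hθ : 0 < θ := lt_of_lt_of_le (by positivity) hlow
  have hB1 : 0 < 64 * n := by omega
  have hpowj : (64 * n : ℝ) ^ j = (64 * n : ℝ) ^ (j - 2) * (64 * n) ^ 2 := by
    rw [← pow_add, Nat.sub_add_cancel hj2]
  have hpow1 : (1 : ℝ) ≤ (64 * n : ℝ) ^ (j - 2) := one_le_pow₀ (by linarith)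
  have hup' : θ * (64 * n : ℝ) ^ j ≤ 16 * n := by
    rw [← div_eq_mul_inv, le_div_iff₀ hbpos] at hup
    push_cast at hup
    exact hup
  have hlow' : 1 / 2 ≤ θ * (64 * n : ℝ) ^ j := by
    have := mul_le_mul_of_nonneg_right hlow hbpos.le
    rwa [div_mul_eq_mul_div, inv_mul_cancel₀ hbpos.ne'] at this
  have hy : a₀ ≤ (64 * n) ^ J := haB.trans (Nat.le_self_pow (by omega) _)
  obtain ⟨k, hkA, hk, hkB, hgap⟩ := h.exists_gap ha₀ hn₀ hy (by positivity) (le_refl (64 * n))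
    (by rwa [← pow_succ'])
  -- The start of the descent, chosen so that 1/4 < θu₀ ≤ 1/2.
  obtain ⟨u₀, hu₀A, hvu, huv⟩ := h.exists_mem_Ioc_two_mul ha₀ hn₀ (v := ⌊1 / (4 * θ)⌋₊) (by
    refine Nat.le_floor ?_
    rw [le_div_iff₀ (by positivity)]
    have h1 : (a₀ : ℝ) ≤ 64 * n := by exact_mod_cast haB
    have h2 : (64 * n : ℝ) * (4 * θ) ≤ 1 := by
      have h3 : θ * (64 * n : ℝ) ^ 2 ≤ 16 * n := by
        refine le_trans ?_ hup'
        rw [hpowj]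
        gcongr
        exact le_mul_of_one_le_left (by positivity) hpow1
      have h4 : (16 * n : ℝ) * (64 * n * (4 * θ)) ≤ 16 * n * 1 := by linarith
      exact le_of_mul_le_mul_left h4 (by positivity)
    calc (a₀ : ℝ) * (4 * θ) ≤ 64 * n * (4 * θ) := by gcongr
      _ ≤ 1 := h2)
  have h4 : 1 / 4 < θ * u₀ := by
    have := Nat.lt_of_floor_lt hvu
    rw [div_lt_iff₀ (by positivity)] at this
    linarith
  have h2 : θ * u₀ ≤ 1 / 2 := by
    have h5 : (u₀ : ℝ) ≤ 2 * ⌊1 / (4 * θ)⌋₊ := by exact_mod_cast huv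
    have h6 := Nat.floor_le (a := 1 / (4 * θ)) (by positivity)
    have h7 : θ * u₀ ≤ θ * (2 * (1 / (4 * θ))) := by
      gcongr
      linarith
    have h8 : θ * (2 * (1 / (4 * θ))) = 1 / 2 := by field_simp; norm_num
    linarith
  have huj : u₀ ≤ (64 * n) ^ j := by
    have : (u₀ : ℝ) ≤ (64 * n : ℝ) ^ j := le_of_mul_le_mul_left (h2.trans hlow') hθ
    exact_mod_cast this
  have hjJ' : (64 * n) ^ j ≤ (64 * n) ^ J := Nat.pow_le_pow_right hB1 hjJ
  refine le_countIoc_of_descent hn hu₀A h4 huj ?_ ?_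
  -- At u ≤ B^(j-2) one has θu ≤ 16n/B², below the lowest window. B^(j-1) would only give 1/4, which
  -- is why a scale spans two blocks.
  · intro u hu
    by_contra hcon
    have h5 : (u : ℝ) ≤ (64 * n : ℝ) ^ (j - 2) := by exact_mod_cast not_lt.1 hcon
    rw [div_le_iff₀ (by positivity)] at hu
    have h6 : θ * u * (64 * n) ^ 2 ≤ 16 * n := by
      refine le_trans ?_ hup'
      rw [hpowj, mul_assoc]
      gcongr
    nlinarith
  · intro u huA hu hu3
    refine h.exists_descent (hn₀.trans hy) hkA hk hkB hgap hθ (by linarith) ?_ huA (by omega) hu3 ?_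
    · intro c hc h5 h6
      have := hnear c (by
        rw [Set.Finite.mem_toFinset]
        exact ⟨hc, h5, by rwa [pow_succ']⟩)
      push_cast at this
      exact this
    · refine le_trans ?_ h2
      gcongr

/-! ### Summation over blocks and choice of parameters -/

theorem mul_sub_three_le_two_mul_sum {a : ℕ → ℕ} {n K : ℕ} (hK : 6 * K ≤ n)
    (h : ∀ J < K, a J < n →
      ((Finset.Icc 2 J).filter (fun j => a (j - 2) + a (j - 1) < n)).card ≤ a J) :
    (K : ℤ) * (K - 3) ≤ 2 * ∑ J ∈ Finset.range K, (a J : ℤ) := by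
  classical
  set H := (Finset.range K).filter (fun J => n ≤ 2 * a J) with hH
  -- A non-sparse scale j has a heavy block among j - 2 and j - 1, so at most 2|H| scales are lost
  -- in each light block. A heavy block has 2a(J) ≥ n ≥ 6K, and its surplus 4K repays this loss over
  -- all K blocks.
  have hterm : ∀ J ∈ Finset.range K,
      2 * ((J : ℤ) - 1 - 2 * H.card) + (if J ∈ H then 4 * (K : ℤ) else 0) ≤ 2 * (a J : ℤ) := by
    intro J hJ
    have hJK := Finset.mem_range.1 hJ
    split_ifs with hmem
    · have := (Finset.mem_filter.1 hmem).2
      omega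
    · have hJn : 2 * a J < n := by
        by_contra hcon
        exact hmem (Finset.mem_filter.2 ⟨hJ, by omega⟩)
      have h1 := h J hJK (by omega)
      have h2 := Finset.card_filter_add_card_filter_not (s := Finset.Icc 2 J)
        (fun j => a (j - 2) + a (j - 1) < n)
      have h3 : ((Finset.Icc 2 J).filter (fun j => ¬ a (j - 2) + a (j - 1) < n)).card ≤
          H.card + H.card := by
        calc _ ≤ (H.image (· + 2) ∪ H.image (· + 1)).card := by
              refine Finset.card_le_card fun j hj => ?_
              obtain ⟨hj, hja⟩ := Finset.mem_filter.1 hj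
              have hj := Finset.mem_Icc.1 hj
              rw [Finset.mem_union, Finset.mem_image, Finset.mem_image]
              rcases le_or_gt n (2 * a (j - 2)) with h4 | h4
              · exact Or.inl ⟨j - 2, Finset.mem_filter.2 ⟨Finset.mem_range.2 (by omega), h4⟩,
                  by omega⟩
              · exact Or.inr ⟨j - 1, Finset.mem_filter.2 ⟨Finset.mem_range.2 (by omega), by omega⟩,
                  by omega⟩
          _ ≤ _ := (Finset.card_union_le _ _).trans
              (add_le_add Finset.card_image_le Finset.card_image_le)
      rw [Nat.card_Icc] at h2
      omega
  have hsum := Finset.sum_le_sum hterm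
  rw [Finset.sum_add_distrib, ← Finset.mul_sum, ← Finset.mul_sum, Finset.sum_ite_mem,
    Finset.inter_eq_right.2 (Finset.filter_subset _ _), Finset.sum_const,
    Finset.sum_sub_distrib, Finset.sum_sub_distrib, Finset.sum_const, Finset.sum_const,
    Finset.card_range] at hsum
  have hgauss : 2 * ∑ J ∈ Finset.range K, (J : ℤ) = K * (K - 1) := by
    clear hsum hterm hH H h hK
    induction K with
    | zero => simp
    | succ K ih =>
      rw [Finset.sum_range_succ, mul_add, ih]
      push_cast
      ring
  simp only [nsmul_eq_mul] at hsum
  linarith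

theorem HasSecondRep.mul_sub_three_le {A : Set ℕ} {n₀ a₀ n K : ℕ} (h : HasSecondRep A n₀)
    (ha₀ : a₀ ∈ A) (hn₀ : n₀ ≤ a₀) (hn : 0 < n) (haB : a₀ ≤ 64 * n) (hK : 6 * K ≤ n) {x : ℝ}
    (hx : (64 * n : ℝ) ^ K ≤ x) : (K : ℝ) * (K - 3) ≤ 2 * countUpTo A x := by
  have hB : 0 < 64 * n := by omega
  have h1 := mul_sub_three_le_two_mul_sum
    (a := fun J => countIoc A ((64 * n) ^ J) ((64 * n) ^ (J + 1))) hK (fun J _ hJ => by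
      refine le_trans (Finset.card_le_card fun j hj => ?_)
        (h.card_sparse_le_countIoc ha₀ hn₀ hn haB hJ)
      obtain ⟨hj, hja⟩ := Finset.mem_filter.1 hj
      refine Finset.mem_filter.2 ⟨hj, ?_⟩
      have hj := Finset.mem_Icc.1 hj
      rw [show j - 2 + 1 = j - 1 by omega, show j - 1 + 1 = j by omega] at hja
      rwa [← countIoc_add A (Nat.pow_le_pow_right hB (show j - 2 ≤ j - 1 by omega))
        (Nat.pow_le_pow_right hB (show j - 1 ≤ j by omega))])
  have h2 : countIoc A 1 ((64 * n) ^ K) ≤ countUpTo A x := by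
    refine Set.ncard_le_ncard ?_ ?_
    · rintro c ⟨hc, _, hcK⟩
      refine ⟨hc, le_trans ?_ hx⟩
      exact_mod_cast hcK
    · exact (Set.finite_Iic ⌊x⌋₊).subset fun c hc => Nat.le_floor hc.2
  rw [← Nat.cast_sum, sum_countIoc_pow A hB] at h1
  have h3 : ((K : ℤ) * (K - 3) : ℤ) ≤ 2 * (countUpTo A x : ℤ) := by omega
  exact_mod_cast h3

/-- Choice of the block length and of the number of blocks. -/
theorem exists_block_parameters {a₀ : ℕ} {x : ℝ} (hℓ : 2500 ≤ Real.log (Real.log x))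
    (ha₀ : a₀ ≤ Real.log (Real.log x)) (hX : 5 * Real.log (Real.log x) ^ 2 ≤ Real.log x)
    (hx : 0 < x) :
    ∃ n K : ℕ, 0 < n ∧ a₀ ≤ 64 * n ∧ 6 * K ≤ n ∧ (64 * n : ℝ) ^ K ≤ x ∧
      Real.log x / Real.log (Real.log x) < (K : ℝ) - 3 := by
  set X := Real.log x with hXdef
  set l := Real.log X with hl
  have hl0 : 0 < l := by linarith
  have hX0 : 0 < X := by nlinarith
  set T := X / l with hT
  have hTl : T * l = X := by rw [hT]; field_simp
  have hTge : 5 * l ≤ T := by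
    rw [hT, le_div_iff₀ hl0]
    linarith
  have hceil := Nat.le_ceil (12 * T)
  have hceil' := Nat.ceil_lt_add_one (a := 12 * T) (by linarith)
  set n := ⌈12 * T⌉₊ with hn
  have hn0 : (0 : ℝ) < n := by linarith
  -- The saving of 1 makes X / log(64n) exceed T by at least T/l ≥ 5, which absorbs the floor and
  -- the 3 in K - 3. The threshold 2500 covers 64 · 13 · 3.
  have hupper : Real.log (64 * n) ≤ l - 1 := by
    have he : Real.exp 1 < 3 := Real.exp_one_lt_three
    have : (64 * n : ℝ) * Real.exp 1 ≤ X := by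
      calc (64 * n : ℝ) * Real.exp 1 ≤ (64 * (13 * T)) * 3 := by
            gcongr
            linarith
        _ ≤ T * l := by nlinarith
        _ = X := hTl
    have h2 := Real.log_le_log (by positivity) this
    rw [Real.log_mul (by positivity) (Real.exp_pos 1).ne', Real.log_exp] at h2
    linarith
  -- This gives K ≤ 2T, hence 6K ≤ 12T ≤ n.
  have hlower : l / 2 ≤ Real.log (64 * n) := by
    have h1 : Real.log T ≤ Real.log (64 * n) := Real.log_le_log (by linarith) (by linarith)
    rw [hT, Real.log_div hX0.ne' hl0.ne', ← hl] at h1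
    have h2 := Real.log_le_sub_one_of_pos (show 0 < l / 2 by linarith)
    rw [Real.log_div hl0.ne' (by norm_num)] at h2
    have h3 := Real.log_two_lt_d9
    linarith
  have hlog0 : 0 < Real.log (64 * n) := by linarith
  have hK := Nat.floor_le (a := X / Real.log (64 * n)) (by positivity)
  have hK' := Nat.lt_floor_add_one (X / Real.log (64 * n))
  set K := ⌊X / Real.log (64 * n)⌋₊ with hKdef
  refine ⟨n, K, by exact_mod_cast hn0, ?_, ?_, ?_, ?_⟩
  · have : (a₀ : ℝ) ≤ 64 * n := by linarith
    exact_mod_cast this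
  · have : X / Real.log (64 * n) ≤ 2 * T := by
      rw [div_le_iff₀ hlog0]
      nlinarith
    have h2 : (6 * K : ℝ) ≤ n := by linarith
    exact_mod_cast h2
  · rw [← Real.log_le_log_iff (by positivity) hx, Real.log_pow, ← le_div_iff₀ hlog0]
    exact hK
  · have h1 : T + 5 ≤ X / Real.log (64 * n) := by
      rw [le_div_iff₀ hlog0]
      nlinarith
    linarith

theorem theorem1 (A : Set ℕ) (hA : A.Infinite)
    (hr : ∀ᶠ n : ℕ in atTop, repCount A n ≠ 1) :
    ∀ᶠ x : ℝ in atTop,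
      (countUpTo A x : ℝ) > (1 / 2 : ℝ) * (Real.log x / Real.log (Real.log x)) ^ 2 := by
  obtain ⟨n₀, hn₀⟩ := eventually_atTop.1 hr
  have h := hasSecondRep_of_repCount_ne_one hn₀
  obtain ⟨a₀, ha₀, hna⟩ := hA.exists_gt n₀
  have hll := Real.tendsto_log_atTop.comp Real.tendsto_log_atTop
  have hsq := Real.tendsto_log_atTop.eventually
    ((Real.isLittleO_pow_log_id_atTop (n := 2)).bound (show (0 : ℝ) < 1 / 5 by norm_num))
  filter_upwards [hll.eventually_ge_atTop 2500, hll.eventually_ge_atTop (a₀ : ℝ), hsq,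
    eventually_gt_atTop 1] with x h1 h2 h3 h4
  simp only [Function.comp_apply] at h1 h2
  have hX : 0 < Real.log x := Real.log_pos h4
  rw [Real.norm_of_nonneg (by positivity), id, Real.norm_of_nonneg hX.le] at h3
  obtain ⟨n, K, hn, ha, hK, hx, hT⟩ :=
    exists_block_parameters h1 h2 (by linarith) (by linarith)
  have hcount := h.mul_sub_three_le ha₀ hna.le hn ha hK hx
  have hT0 : 0 < Real.log x / Real.log (Real.log x) := div_pos hX (by linarith)
  nlinarith
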